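/- There exist absolute constants $A, C > 0$ and $N_0 \in \mathbb{N}$ such that for every integer $N \geq N_0$ and all complex coefficients $(a_n)_{n \in \mathbb{Z}}$, $$\Big\|\sum_{|n| \leq N} a_n e^{2\pi i (nx + n^2 t)}\Big\|_{L^{6}(\mathbb{T}^2)} \leq A \exp\Big(C\,\frac{\log N}{\log\log N}\Big)\Big(\sum_{|n| \leq N}|a_n|^{2}\Big)^{1/2},$$ where $\mathbb{T}^2 = (\mathbb{R}/\mathbb{Z})^2$ carries its Haar probability measure in the variables $(x,t)$. -/

import Mathlib

/-- The exponential sum `∑_{|n| ≤ N} a_n e^{2πi(n x + n² t)}`, as a function of `(x, t)` on the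
torus `𝕋² = (ℝ/ℤ)²`. Here `fourier k` is the character `x ↦ e^{2πi k x}` of `ℝ/ℤ`. -/
noncomputable def parabolaExpSum (N : ℕ) (a : ℤ → ℂ) (p : UnitAddCircle × UnitAddCircle) : ℂ :=
  ∑ n ∈ Finset.Icc (-(N : ℤ)) (N : ℤ), a n * (fourier n p.1 * fourier (n ^ 2) p.2)

/-- At the class of `(x, t) ∈ ℝ²` the function is the usual exponential sum. -/
theorem parabolaExpSum_coe (N : ℕ) (a : ℤ → ℂ) (x t : ℝ) :
    parabolaExpSum N a ((x : UnitAddCircle), (t : UnitAddCircle)) =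
      ∑ n ∈ Finset.Icc (-(N : ℤ)) (N : ℤ),
        a n * Complex.exp (2 * Real.pi * Complex.I * ((n : ℂ) * x + (n : ℂ) ^ 2 * t)) := by
  unfold parabolaExpSum
  refine Finset.sum_congr rfl fun n _ => ?_
  rw [fourier_coe_apply, fourier_coe_apply, ← Complex.exp_add]
  congr 2
  push_cast
  ring

/-!
Write `f` for the exponential sum. Since `‖f‖₆⁶ = ‖f³‖₂²` and `f³` is a trigonometric polynomial
whose frequency `(A, B)` arises from the triples `(x, y, z) ∈ [-N, N]³` with `x + y + z = A` and
`x² + y² + z² = B`, orthogonality and Cauchy–Schwarz give `‖f‖₆⁶ ≤ R (∑ |aₙ|²)³`, where `R` bounds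
the number of such triples (`eLpNorm_six_parabolaExpSum_le`).

Eliminating `z` and centring, the triples inject into the representations of an integer
`M ≤ 108 N²` by the form `u² + uv + v²` (`card_triples_le`). There are at most `36 d(M)²` of these
when `M ≠ 0` (`card_represent_le`): primitive representations correspond, boundedly many to one, to
roots of `t² + t + 1` modulo `M`, and a root is determined up to three choices by a divisor of `M`
(`ZMod.card_le_of_cyclotomic_three_roots`). This replaces the arithmetic of the Eisenstein integers
by gcd computations.

The classical divisor bound `d(M) ≤ exp (O (log N / log log N))`, proved by comparing `d(M)` with
`M ^ ε` for `ε = 2 / log log N` (`card_divisors_le_exp`), completes the argument.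
-/

/-! ### Representations by the form `u² + uv + v²` -/

/-- If `a` and `b` share the gcd `d` with `M = d m`, then `d` divides both of them and `m` divides
both `a + c` and `b + c`, so `d` and `m` divide `a - b`. A common divisor of `d` and `m` divides
`c` and `c ^ 2 + 3`, hence `3`, which is all that `d m ∣ a - b` can miss. -/
theorem Int.dvd_three_mul_sub_of_gcd_eq {M a b c : ℤ} (hM : M ≠ 0)
    (ha : M ∣ a * (a + c)) (hb : M ∣ b * (b + c)) (hc : M ∣ c ^ 2 + 3)
    (hab : Int.gcd a M = Int.gcd b M) : M ∣ 3 * (a - b) := by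
  have key : ∀ x : ℤ, M ∣ x * (x + c) → ∀ m : ℤ, M = Int.gcd x M * m → m ∣ x + c := by
    intro x hx m hm
    have hd : (Int.gcd x M : ℤ) ≠ 0 := by
      intro h; rw [h] at hm; simp at hm; exact hM hm
    obtain ⟨x', hx'⟩ : (Int.gcd x M : ℤ) ∣ x := Int.gcd_dvd_left ..
    have hcop : IsCoprime m x' := by
      have h1 := Int.gcd_eq_gcd_ab x M
      refine ⟨Int.gcdB x M, Int.gcdA x M, ?_⟩
      apply mul_left_cancel₀ hd
      calc (Int.gcd x M : ℤ) * (Int.gcdB x M * m + Int.gcdA x M * x')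
          = (Int.gcd x M * x') * Int.gcdA x M + (Int.gcd x M * m) * Int.gcdB x M := by ring
        _ = Int.gcd x M * 1 := by rw [← hx', ← hm, mul_one, ← h1]
    refine hcop.dvd_of_dvd_mul_left ?_
    apply (mul_dvd_mul_iff_left hd).1
    rw [← mul_assoc, ← hm, ← hx']
    exact hx
  obtain ⟨m, hm⟩ : (Int.gcd a M : ℤ) ∣ M := Int.gcd_dvd_right ..
  have hma := key a ha m hm
  have hmb := key b hb m (by rw [← hab]; exact hm)
  have hda : (Int.gcd a M : ℤ) ∣ a := Int.gcd_dvd_left ..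
  have hdb : (Int.gcd a M : ℤ) ∣ b := by rw [hab]; exact Int.gcd_dvd_left ..
  generalize (Int.gcd a M : ℤ) = d at *
  have h1 : d ∣ a - b := dvd_sub hda hdb
  have h2 : m ∣ a - b := by simpa using dvd_sub hma hmb
  have hg3 : (Int.gcd d m : ℤ) ∣ 3 := by
    have hgd : (Int.gcd d m : ℤ) ∣ d := Int.gcd_dvd_left ..
    have hgm : (Int.gcd d m : ℤ) ∣ m := Int.gcd_dvd_right ..
    have hgc : (Int.gcd d m : ℤ) ∣ c := by
      simpa using dvd_sub (hgm.trans hma) (hgd.trans hda)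
    have h5 : (Int.gcd d m : ℤ) ∣ c ^ 2 + 3 := (hgd.trans ⟨m, hm⟩).trans hc
    exact (dvd_add_right (dvd_pow hgc two_ne_zero)).1 h5
  obtain ⟨k, hk⟩ := hg3
  obtain ⟨r, hr⟩ := h1
  obtain ⟨s, hs⟩ := h2
  have hgg := Int.gcd_eq_gcd_ab d m
  refine ⟨k * (s * Int.gcdA d m + r * Int.gcdB d m), ?_⟩
  calc 3 * (a - b) = k * (d * Int.gcdA d m * (a - b) + m * Int.gcdB d m * (a - b)) := by
        rw [hk, hgg]; ring
    _ = k * (d * Int.gcdA d m * (m * s) + m * Int.gcdB d m * (d * r)) := by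
        rw [← hs, ← hr]
    _ = _ := by rw [hm]; ring

/-- Relative to a fixed root `t₀`, any root satisfies `(t - t₀) (t - t₀ + (2 t₀ + 1)) = 0`, with
`(2 t₀ + 1) ^ 2 = -3`. So the divisor `gcd (t - t₀, M)` determines `3 t`, and `t` up to three
choices. -/
theorem ZMod.card_le_of_cyclotomic_three_roots (M : ℕ) [NeZero M] (T : Finset (ZMod M))
    (hT : ∀ t ∈ T, t ^ 2 + t + 1 = 0) : T.card ≤ 3 * M.divisors.card := by
  classical
  rcases T.eq_empty_or_nonempty with rfl | ⟨t₀, ht₀⟩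
  · simp
  have hM : M ≠ 0 := NeZero.ne M
  refine Finset.card_le_mul_card_image_of_maps_to
    (f := fun t : ZMod M => Int.gcd ((t - t₀).val : ℤ) M) ?_ 3 ?_
  · intro t _
    rw [Nat.mem_divisors]
    exact ⟨by exact_mod_cast Int.gcd_dvd_right (a := ((t - t₀).val : ℤ)) (b := (M : ℤ)), hM⟩
  · intro d _
    rcases (T.filter fun t => Int.gcd ((t - t₀).val : ℤ) M = d).eq_empty_or_nonempty with
      h | ⟨t₁, ht₁⟩
    · rw [h]; simp
    have hroot : ∀ t ∈ T, (M : ℤ) ∣ ((t - t₀).val : ℤ) * ((t - t₀).val + (2 * t₀.val + 1)) := by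
      intro t ht
      rw [← ZMod.intCast_zmod_eq_zero_iff_dvd]
      push_cast
      rw [ZMod.natCast_zmod_val, ZMod.natCast_zmod_val]
      linear_combination hT t ht - hT t₀ ht₀
    have hc : (M : ℤ) ∣ (2 * t₀.val + 1 : ℤ) ^ 2 + 3 := by
      rw [← ZMod.intCast_zmod_eq_zero_iff_dvd]
      push_cast
      rw [ZMod.natCast_zmod_val]
      linear_combination 4 * hT t₀ ht₀
    rw [Finset.mem_filter] at ht₁
    calc _ ≤ (Finset.univ.filter fun s : ZMod M => 3 • s = 0).card := by
          refine Finset.card_le_card_of_injOn (fun t => t - t₁) ?_ (sub_left_injective.injOn)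
          intro t ht
          simp only [Finset.coe_filter, Set.mem_ofPred_eq, Finset.mem_univ, true_and] at ht ⊢
          have := Int.dvd_three_mul_sub_of_gcd_eq (by exact_mod_cast hM) (hroot t ht.1)
            (hroot t₁ ht₁.1) hc (ht.2.trans ht₁.2.symm)
          rw [← ZMod.intCast_zmod_eq_zero_iff_dvd] at this
          push_cast at this
          rw [ZMod.natCast_zmod_val, ZMod.natCast_zmod_val] at this
          rw [nsmul_eq_mul]
          push_cast
          linear_combination this
      _ ≤ 3 := IsAddCyclic.card_nsmul_eq_zero_le (by norm_num)

/-- A primitive representation `(u, v)` gives a root `u / v` of `t ^ 2 + t + 1` modulo `M`. If `z`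
and `w` give the same root, then `M ∣ Im (z̄ w)` (in Eisenstein integers, up to normalization),
while `|z̄ w| = M` leaves at most twelve values for `z̄ w`. -/
theorem card_primitive_le (M : ℕ) (hM : M ≠ 0) (S : Finset (ℤ × ℤ))
    (hS : ∀ p ∈ S, p.1 ^ 2 + p.1 * p.2 + p.2 ^ 2 = M ∧ IsCoprime p.1 p.2) :
    S.card ≤ 36 * M.divisors.card := by
  classical
  have : NeZero M := ⟨hM⟩
  have hM0 : (M : ℤ) ≠ 0 := by exact_mod_cast hM
  have hunit : ∀ p ∈ S, ((p.2 : ℤ) : ZMod M) * ((p.2 : ℤ) : ZMod M)⁻¹ = 1 := by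
    intro p hp
    apply ZMod.mul_inv_of_unit
    rw [ZMod.coe_int_isUnit_iff_isCoprime, ← (hS p hp).1, add_assoc, sq p.2, ← add_mul]
    exact ((hS p hp).2.pow_left (m := 2)).add_mul_right_left (p.1 + p.2)
  have hroot : ∀ p ∈ S, ((p.1 : ℤ) : ZMod M) ^ 2 + p.1 * p.2 + (p.2 : ZMod M) ^ 2 = 0 := by
    intro p hp
    have := congrArg (Int.cast : ℤ → ZMod M) (hS p hp).1
    push_cast at this
    simpa using this
  let f : ℤ × ℤ → ZMod M := fun p => (p.1 : ZMod M) * (p.2 : ZMod M)⁻¹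
  have himg : (S.image f).card ≤ 3 * M.divisors.card := by
    refine ZMod.card_le_of_cyclotomic_three_roots M _ ?_
    intro t ht
    obtain ⟨p, hp, rfl⟩ := Finset.mem_image.1 ht
    have h1 := hunit p hp
    have h2 := hroot p hp
    simp only [f]
    generalize ((p.2 : ZMod M))⁻¹ = w at *
    linear_combination w ^ 2 * h2 - (p.1 * w + p.2 * w + 1) * h1
  have hfib : S.card ≤ 12 * (S.image f).card := by
    refine Finset.card_le_mul_card_image S 12 ?_
    intro t _
    rcases (S.filter fun p => f p = t).eq_empty_or_nonempty with h | ⟨q, hq⟩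
    · rw [h]; simp
    rw [Finset.mem_filter] at hq
    have hq1 := (hS q hq.1).1
    have hpre : ∀ p ∈ S.filter (fun p => f p = t), ∃ k ∈ ({-1, 0, 1} : Finset ℤ),
        ∃ l ∈ ({-2, -1, 1, 2} : Finset ℤ), q.1 * p.2 - p.1 * q.2 = M * k ∧
          2 * q.1 * p.1 + 2 * q.2 * p.2 + q.1 * p.2 + p.1 * q.2 = M * l := by
      intro p hp
      rw [Finset.mem_filter] at hp
      have hp1 := (hS p hp.1).1
      have hd : (M : ℤ) ∣ q.1 * p.2 - p.1 * q.2 := by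
        rw [← ZMod.intCast_zmod_eq_zero_iff_dvd]
        push_cast
        have h1 := hunit p hp.1
        have h2 := hunit q hq.1
        have h3 : f p = f q := hp.2.trans hq.2.symm
        simp only [f] at h3
        generalize ((p.2 : ZMod M))⁻¹ = w at *
        generalize ((q.2 : ZMod M))⁻¹ = w' at *
        linear_combination (-(p.2 : ZMod M) * q.2) * h3 + p.1 * q.2 * h1 - q.1 * p.2 * h2
      obtain ⟨k, hk⟩ := hd
      -- The identity `Re² + 3 Im² = |z|² |w|²`, multiplied by `4`.
      have hid : (2 * q.1 * p.1 + 2 * q.2 * p.2 + q.1 * p.2 + p.1 * q.2) ^ 2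
          + 3 * (q.1 * p.2 - p.1 * q.2) ^ 2 = 4 * (M : ℤ) ^ 2 := by
        calc _ = 4 * ((q.1 ^ 2 + q.1 * q.2 + q.2 ^ 2) * (p.1 ^ 2 + p.1 * p.2 + p.2 ^ 2)) := by ring
          _ = _ := by rw [hq1, hp1]; ring
      generalize 2 * q.1 * p.1 + 2 * q.2 * p.2 + q.1 * p.2 + p.1 * q.2 = s at *
      rw [hk] at hid
      have hsq : s ^ 2 = (4 - 3 * k ^ 2) * (M : ℤ) ^ 2 := by linear_combination hid
      have hMpos : (0 : ℤ) < (M : ℤ) ^ 2 := by positivity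
      have hk2 : 0 ≤ 4 - 3 * k ^ 2 := by
        by_contra! h
        have := mul_neg_of_neg_of_pos h hMpos
        rw [← hsq] at this
        exact absurd this (not_lt.2 (sq_nonneg s))
      have hk3 : -1 ≤ k := by nlinarith
      have hk4 : k ≤ 1 := by nlinarith
      refine ⟨k, by simp only [Finset.mem_insert, Finset.mem_singleton]; omega, ?_⟩
      interval_cases k
      · have : (s - M) * (s + M) = 0 := by linear_combination hsq
        rcases mul_eq_zero.1 this with h | h
        · exact ⟨1, by simp, hk, by linear_combination h⟩
        · exact ⟨-1, by simp, hk, by linear_combination h⟩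
      · have : (s - 2 * M) * (s + 2 * M) = 0 := by linear_combination hsq
        rcases mul_eq_zero.1 this with h | h
        · exact ⟨2, by simp, hk, by linear_combination h⟩
        · exact ⟨-2, by simp, hk, by linear_combination h⟩
      · have : (s - M) * (s + M) = 0 := by linear_combination hsq
        rcases mul_eq_zero.1 this with h | h
        · exact ⟨1, by simp, hk, by linear_combination h⟩
        · exact ⟨-1, by simp, hk, by linear_combination h⟩
    choose! k hk l hl hkl using hpre
    -- For fixed `q` the two bilinear forms are linear in `p` with determinant `2 M ≠ 0`.
    refine (Finset.card_le_card_of_injOn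
      (t := ({-1, 0, 1} : Finset ℤ) ×ˢ ({-2, -1, 1, 2} : Finset ℤ))
      (fun p => (k p, l p)) ?_ ?_).trans
      (by decide)
    · intro p hp
      exact Finset.mem_product.2 ⟨hk p hp, hl p hp⟩
    · intro p hp p' hp' hpp
      obtain ⟨h1, h2⟩ := Prod.mk.inj hpp
      obtain ⟨e1, e2⟩ := hkl p hp
      obtain ⟨e3, e4⟩ := hkl p' hp'
      rw [h1] at e1
      rw [h2] at e2
      have hu : 2 * (M : ℤ) * (p.1 - p'.1) = 0 := by
        rw [← hq1]
        linear_combination q.1 * (e2 - e4) - (2 * q.2 + q.1) * (e1 - e3)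
      have hv : 2 * (M : ℤ) * (p.2 - p'.2) = 0 := by
        rw [← hq1]
        linear_combination q.2 * (e2 - e4) + (2 * q.1 + q.2) * (e1 - e3)
      ext
      · simpa [hM, sub_eq_zero] using hu
      · simpa [hM, sub_eq_zero] using hv
  calc S.card ≤ 12 * (3 * M.divisors.card) := hfib.trans (Nat.mul_le_mul_left _ himg)
    _ = _ := by ring

/-- Sort the representations by the gcd `g` of the coordinates; dividing by `g` yields primitive
representations of `M / g ^ 2`. -/
theorem card_represent_le (M : ℕ) (hM : M ≠ 0) (S : Finset (ℤ × ℤ))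
    (hS : ∀ p ∈ S, p.1 ^ 2 + p.1 * p.2 + p.2 ^ 2 = M) :
    S.card ≤ 36 * M.divisors.card ^ 2 := by
  classical
  have hM0 : (M : ℤ) ≠ 0 := by exact_mod_cast hM
  have hg : ∀ p ∈ S, (Int.gcd p.1 p.2) ^ 2 ∣ M := by
    intro p hp
    have h1 : (Int.gcd p.1 p.2 : ℤ) ∣ p.1 := Int.gcd_dvd_left ..
    have h2 : (Int.gcd p.1 p.2 : ℤ) ∣ p.2 := Int.gcd_dvd_right ..
    have : ((Int.gcd p.1 p.2 : ℕ) : ℤ) ^ 2 ∣ M := by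
      rw [← hS p hp]
      refine dvd_add (dvd_add (pow_dvd_pow_of_dvd h1 2) ?_) (pow_dvd_pow_of_dvd h2 2)
      rw [sq]; exact mul_dvd_mul h1 h2
    exact_mod_cast this
  have := Finset.card_le_mul_card_image_of_maps_to (s := S) (t := M.divisors)
    (f := fun p : ℤ × ℤ => Int.gcd p.1 p.2)
    (fun p hp => Nat.mem_divisors.2 ⟨(dvd_pow_self _ two_ne_zero).trans (hg p hp), hM⟩)
    (36 * M.divisors.card) ?_
  · calc _ ≤ _ := this
      _ = _ := by ring
  intro g hgM
  rcases (S.filter fun p => Int.gcd p.1 p.2 = g).eq_empty_or_nonempty with h | ⟨q, hq⟩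
  · rw [h]; simp
  rw [Finset.mem_filter] at hq
  obtain ⟨m, hm⟩ := hg q hq.1
  rw [hq.2] at hm
  have hm0 : m ≠ 0 := by rintro rfl; simp at hm; exact hM hm
  have hg0 : g ≠ 0 := by rintro rfl; simp at hm; exact hM hm
  have hgz : (g : ℤ) ≠ 0 := by exact_mod_cast hg0
  have hdiv : ∀ p ∈ S.filter (fun p => Int.gcd p.1 p.2 = g),
      (g : ℤ) * (p.1 / g) = p.1 ∧ (g : ℤ) * (p.2 / g) = p.2 := by
    intro p hp
    rw [Finset.mem_filter] at hp
    rw [← hp.2]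
    exact ⟨Int.mul_ediv_cancel' (Int.gcd_dvd_left ..), Int.mul_ediv_cancel' (Int.gcd_dvd_right ..)⟩
  have hinj : Set.InjOn (fun p : ℤ × ℤ => (p.1 / (g : ℤ), p.2 / (g : ℤ)))
      (S.filter fun p => Int.gcd p.1 p.2 = g) := by
    intro p hp p' hp' h
    obtain ⟨h1, h2⟩ := Prod.mk.inj h
    obtain ⟨e1, e2⟩ := hdiv p hp
    obtain ⟨e3, e4⟩ := hdiv p' hp'
    ext
    · rw [← e1, ← e3, h1]
    · rw [← e2, ← e4, h2]
  rw [← Finset.card_image_of_injOn hinj]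
  refine (card_primitive_le m hm0 _ ?_).trans (Nat.mul_le_mul_left _ (Finset.card_le_card
    (Nat.divisors_subset_of_dvd hM ⟨g ^ 2, by rw [hm]; ring⟩)))
  intro r hr
  obtain ⟨p, hp, rfl⟩ := Finset.mem_image.1 hr
  obtain ⟨e1, e2⟩ := hdiv p hp
  rw [Finset.mem_filter] at hp
  constructor
  · have h := hS p hp.1
    rw [← e1, ← e2, hm] at h
    push_cast at h
    apply mul_left_cancel₀ (pow_ne_zero 2 hgz)
    linear_combination h
  · have h := Int.gcd_eq_gcd_ab p.1 p.2
    rw [hp.2] at h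
    refine ⟨Int.gcdA p.1 p.2, Int.gcdB p.1 p.2, ?_⟩
    apply mul_left_cancel₀ hgz
    linear_combination Int.gcdA p.1 p.2 * e1 + Int.gcdB p.1 p.2 * e2 - h

/-- The vectors `(u, v) = (3 x - A, 3 y - A)` of the triples `(x, y, z)` with sum `A` and sum of
squares `B` all lie on one ellipse `u² + uv + v² = M`, where `2 M = 9 B - 3 A²`. -/
theorem card_triples_le (N : ℕ) (D : ℝ) (hD1 : 1 ≤ D)
    (hD : ∀ M : ℕ, M ≠ 0 → M ≤ 108 * N ^ 2 → (M.divisors.card : ℝ) ≤ D) (A B : ℤ)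
    (S : Finset (ℤ × ℤ × ℤ))
    (hbox : ∀ p ∈ S, |p.1| ≤ N ∧ |p.2.1| ≤ N ∧ |p.2.2| ≤ N)
    (hA : ∀ p ∈ S, p.1 + p.2.1 + p.2.2 = A)
    (hB : ∀ p ∈ S, p.1 ^ 2 + p.2.1 ^ 2 + p.2.2 ^ 2 = B) :
    (S.card : ℝ) ≤ 36 * D ^ 2 := by
  classical
  rcases S.eq_empty_or_nonempty with rfl | ⟨q, hq⟩
  · simp; positivity
  let φ : ℤ × ℤ × ℤ → ℤ × ℤ := fun p => (3 * p.1 - A, 3 * p.2.1 - A)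
  let Q : ℤ × ℤ → ℤ := fun r => r.1 ^ 2 + r.1 * r.2 + r.2 ^ 2
  have hinj : Set.InjOn φ S := by
    intro p hp p' hp' h
    obtain ⟨h1, h2⟩ := Prod.mk.inj h
    have e := hA p hp
    have e' := hA p' hp'
    ext <;> omega
  have hQ : ∀ p ∈ S, 2 * Q (φ p) = 9 * B - 3 * A ^ 2 := by
    intro p hp
    have e := hA p hp
    have e' := hB p hp
    simp only [Q, φ]
    rw [← e', ← e]
    ring
  have hQ0 : 0 ≤ Q (φ q) := by
    simp only [Q]
    nlinarith [sq_nonneg ((φ q).1 + (φ q).2), sq_nonneg (φ q).1, sq_nonneg (φ q).2]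
  obtain ⟨M, hM⟩ := Int.eq_ofNat_of_zero_le hQ0
  have hQM : ∀ r ∈ S.image φ, Q r = M := by
    intro r hr
    obtain ⟨p, hp, rfl⟩ := Finset.mem_image.1 hr
    have := hQ p hp
    have := hQ q hq
    omega
  rw [← Finset.card_image_of_injOn hinj]
  rcases eq_or_ne M 0 with rfl | hM0
  -- For `M = 0` the form, being definite, vanishes only at the origin.
  · have hsub : S.image φ ⊆ {(0, 0)} := by
      intro r hr
      have h := hQM r hr
      simp only [Q, Nat.cast_zero] at h
      have h1 : r.1 = 0 := by
        apply pow_eq_zero_iff (two_ne_zero) |>.1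
        nlinarith [sq_nonneg (r.1 + r.2), sq_nonneg r.1, sq_nonneg r.2]
      have h2 : r.2 = 0 := by
        apply pow_eq_zero_iff (two_ne_zero) |>.1
        nlinarith [sq_nonneg (r.1 + r.2), sq_nonneg r.1, sq_nonneg r.2]
      rw [Finset.mem_singleton]
      exact Prod.ext h1 h2
    have hc : ((S.image φ).card : ℝ) ≤ 1 := by
      exact_mod_cast (Finset.card_le_card hsub).trans (by simp)
    nlinarith
  · have hMN : M ≤ 108 * N ^ 2 := by
      obtain ⟨b1, b2, b3⟩ := hbox q hq
      have e := hA q hq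
      rw [abs_le] at b1 b2 b3
      have h1 : |(φ q).1| ≤ |(6 * N : ℤ)| := by
        rw [abs_of_nonneg (by positivity : (0 : ℤ) ≤ 6 * N), abs_le]
        simp only [φ]
        constructor <;> linarith
      have h2 : |(φ q).2| ≤ |(6 * N : ℤ)| := by
        rw [abs_of_nonneg (by positivity : (0 : ℤ) ≤ 6 * N), abs_le]
        simp only [φ]
        constructor <;> linarith
      have h1 := sq_le_sq.2 h1
      have h2 := sq_le_sq.2 h2
      have : (M : ℤ) ≤ 108 * (N : ℤ) ^ 2 := by
        change _ = (M : ℤ) at hM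
        rw [← hM]
        simp only [Q]
        nlinarith [sq_nonneg ((φ q).1 - (φ q).2)]
      exact_mod_cast this
    have h := card_represent_le M hM0 (S.image φ) hQM
    have hd := hD M hM0 hMN
    calc ((S.image φ).card : ℝ) ≤ 36 * (M.divisors.card : ℝ) ^ 2 := by exact_mod_cast h
      _ ≤ _ := by gcongr

/-! ### The divisor bound -/

open Real in
/-- Compare `d(n) / n ^ ε = ∏ (e + 1) / p ^ (e ε)` factor by factor: a prime `p ≥ 2 ^ (1 / ε)`
contributes at most `1`, and each of the fewer than `2 ^ (1 / ε)` smaller primes at most `2 / ε`. -/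
theorem card_divisors_le_rpow {ε : ℝ} (hε : 0 < ε) (hε1 : ε ≤ 1) {n : ℕ} (hn : n ≠ 0) :
    (n.divisors.card : ℝ) ≤ (n : ℝ) ^ ε * (2 / ε) ^ ((2 : ℝ) ^ (1 / ε)) := by
  set Y : ℝ := (2 : ℝ) ^ (1 / ε) with hY
  have hYpos : 0 < Y := by positivity
  have h2ε : 1 ≤ 2 / ε := by rw [le_div_iff₀ hε]; linarith
  have hfac : ∀ p ∈ n.primeFactors, ((n.factorization p + 1 : ℕ) : ℝ) ≤
      ((p : ℝ) ^ n.factorization p) ^ ε * (if (p : ℝ) < Y then 2 / ε else 1) := by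
    intro p hp
    have hp2 : (2 : ℝ) ≤ p := by exact_mod_cast (Nat.prime_of_mem_primeFactors hp).two_le
    generalize n.factorization p = e
    rw [← rpow_natCast, ← rpow_mul (by positivity), mul_comm (e : ℝ), rpow_mul (by positivity),
      rpow_natCast]
    push_cast
    split_ifs with h
    · have h1 : 1 + ε / 2 ≤ (p : ℝ) ^ ε := by
        calc 1 + ε / 2 ≤ 1 + log 2 * ε := by nlinarith [log_two_gt_d9]
          _ ≤ exp (log 2 * ε) := by linarith [add_one_le_exp (log 2 * ε)]
          _ = (2 : ℝ) ^ ε := by rw [rpow_def_of_pos two_pos]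
          _ ≤ _ := rpow_le_rpow two_pos.le hp2 hε.le
      have h2 : 1 + e * (ε / 2) ≤ ((p : ℝ) ^ ε) ^ e :=
        (one_add_mul_le_pow (by linarith) e).trans (by gcongr)
      calc (e : ℝ) + 1 ≤ e + 2 / ε := by linarith
        _ = (1 + e * (ε / 2)) * (2 / ε) := by field_simp; ring
        _ ≤ _ := by gcongr
    · have h1 : 2 ≤ (p : ℝ) ^ ε := by
        calc (2 : ℝ) = Y ^ ε := by
              rw [hY, ← rpow_mul two_pos.le, one_div_mul_cancel hε.ne', rpow_one]
          _ ≤ _ := rpow_le_rpow hYpos.le (not_lt.1 h) hε.le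
      have h2 : (e : ℝ) + 1 ≤ 2 ^ e := by exact_mod_cast Nat.lt_two_pow_self
      rw [mul_one]
      exact h2.trans (by gcongr)
  rw [Nat.card_divisors hn]
  push_cast
  calc ∏ p ∈ n.primeFactors, ((n.factorization p : ℝ) + 1)
      ≤ ∏ p ∈ n.primeFactors,
          ((p : ℝ) ^ n.factorization p) ^ ε * (if (p : ℝ) < Y then 2 / ε else 1) :=
        Finset.prod_le_prod (fun _ _ => by positivity) (by exact_mod_cast hfac)
    _ = (n : ℝ) ^ ε * (2 / ε) ^ (n.primeFactors.filter fun p : ℕ => (p : ℝ) < Y).card := by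
        rw [Finset.prod_mul_distrib, Real.finsetProd_rpow _ _ (fun _ _ => by positivity),
          Finset.prod_ite, Finset.prod_const, Finset.prod_const_one, mul_one]
        congr 2
        have := Nat.prod_factorization_pow_eq_self hn
        exact_mod_cast this
    _ ≤ _ := by
        gcongr
        rw [← rpow_natCast]
        refine rpow_le_rpow_of_exponent_le h2ε ?_
        have hsub : (n.primeFactors.filter fun p : ℕ => (p : ℝ) < Y) ⊆ Finset.Ico 1 ⌈Y⌉₊ := by
          intro p hp
          rw [Finset.mem_filter] at hp
          rw [Finset.mem_Ico]
          exact ⟨(Nat.prime_of_mem_primeFactors hp.1).one_le, Nat.lt_ceil.2 hp.2⟩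
        have h1 := Finset.card_le_card hsub
        rw [Nat.card_Ico] at h1
        have h2 := Nat.ceil_lt_add_one hYpos.le
        have h3 : 1 ≤ ⌈Y⌉₊ := Nat.ceil_pos.2 hYpos
        have h4 : ((n.primeFactors.filter fun p : ℕ => (p : ℝ) < Y).card : ℝ) ≤
          ((⌈Y⌉₊ - 1 : ℕ) : ℝ) := by exact_mod_cast h1
        rw [Nat.cast_sub h3] at h4
        push_cast at h4
        linarith

open Real in
/-- The divisor bound `d(n) ≤ exp (O (log N / log log N))`, uniform in `0 < n ≤ N ^ 3`. -/
theorem card_divisors_le_exp {N : ℕ} (hN : 2 ≤ log (log N)) {n : ℕ} (hn : n ≠ 0)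
    (hnN : n ≤ N ^ 3) :
    (n.divisors.card : ℝ) ≤ exp (14 * (log N / log (log N))) := by
  have hlog : 0 < log N := by
    by_contra! h
    rcases N.eq_zero_or_pos with rfl | h0
    · norm_num at hN
    · have : log (N : ℝ) = 0 := le_antisymm h (log_natCast_nonneg N)
      rw [this] at hN; norm_num at hN
  have hNpos : (0 : ℝ) < N := by
    rcases N.eq_zero_or_pos with rfl | h0
    · simp at hlog
    · exact_mod_cast h0
  set l := log (log N) with hl
  have hl0 : 0 < l := by linarith
  have hexp : log N = exp l := (exp_log hlog).symm
  -- `ε = 2 / log log N` makes `2 ^ (1 / ε) ≤ (log N) ^ (1 / 2)`, so that the factor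
  -- `(2 / ε) ^ (2 ^ (1 / ε))` is harmless while `N ^ (3 ε) = exp (6 log N / log log N)`.
  have hε : 0 < 2 / l := by positivity
  have hε1 : 2 / l ≤ 1 := by rw [div_le_one hl0]; exact hN
  refine (card_divisors_le_rpow hε hε1 hn).trans ?_
  have h1 : (n : ℝ) ^ (2 / l) ≤ exp (6 * (log N / l)) := by
    calc (n : ℝ) ^ (2 / l) ≤ ((N : ℝ) ^ 3) ^ (2 / l) :=
          rpow_le_rpow (by positivity) (by exact_mod_cast hnN) hε.le
      _ = _ := by
          rw [rpow_def_of_pos (by positivity), log_pow]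
          congr 1; push_cast; ring
  have h2 : (2 / (2 / l)) ^ ((2 : ℝ) ^ (1 / (2 / l))) ≤ exp (8 * (log N / l)) := by
    rw [show 2 / (2 / l) = l by field_simp, rpow_def_of_pos hl0, exp_le_exp]
    have a1 : (2 : ℝ) ^ (1 / (2 / l)) ≤ exp (l / 2) := by
      rw [rpow_def_of_pos two_pos, exp_le_exp, one_div_div]
      nlinarith [log_two_lt_d9]
    have a2 : log l ≤ l := (log_le_sub_one_of_pos hl0).trans (by linarith)
    -- `e ^ x ≥ x ^ 2 / 2` at `x = l / 2`.
    have a3 : l ^ 2 ≤ 8 * exp (l / 2) := by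
      have := quadratic_le_exp_of_nonneg (x := l / 2) (by positivity)
      nlinarith
    have a4 : exp l = exp (l / 2) * exp (l / 2) := by rw [← exp_add]; congr 1; ring
    calc log l * 2 ^ (1 / (2 / l)) ≤ l * exp (l / 2) := by gcongr
      _ = l ^ 2 * exp (l / 2) / l := by field_simp
      _ ≤ 8 * exp (l / 2) * exp (l / 2) / l := by gcongr
      _ = _ := by rw [hexp, a4]; ring
  calc _ ≤ exp (6 * (log N / l)) * exp (8 * (log N / l)) := by gcongr
    _ = _ := by rw [← exp_add]; congr 1; ring

/-! ### Mean values on the torus -/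

/-- The character `(x, t) ↦ e^{2πi(k₁ x + k₂ t)}` of the torus with frequency `k = (k₁, k₂)`. -/
noncomputable def torusChar (k : ℤ × ℤ) (p : UnitAddCircle × UnitAddCircle) : ℂ :=
  fourier k.1 p.1 * fourier k.2 p.2

theorem continuous_torusChar (k : ℤ × ℤ) : Continuous (torusChar k) := by
  unfold torusChar
  fun_prop

theorem torusChar_sub (k l : ℤ × ℤ) (p : UnitAddCircle × UnitAddCircle) :
    torusChar (k - l) p = torusChar k p * (starRingEnd ℂ) (torusChar l p) := by
  rw [torusChar, torusChar, torusChar, Prod.fst_sub, Prod.snd_sub, sub_eq_add_neg, sub_eq_add_neg,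
    fourier_add, fourier_add, fourier_neg, fourier_neg, map_mul]
  ring

theorem UnitAddCircle.integral_fourier (n : ℤ) :
    ∫ x : UnitAddCircle, (fourier n x : ℂ) = if n = 0 then 1 else 0 := by
  split_ifs with h
  · simp [h, MeasureTheory.measureReal_def]
  · exact MeasureTheory.integral_eq_zero_of_add_right_eq_neg
      (fourier_add_half_inv_index h one_pos)

theorem integral_torusChar (k : ℤ × ℤ) : ∫ p, torusChar k p = if k = 0 then 1 else 0 := by
  unfold torusChar
  rw [MeasureTheory.Measure.volume_eq_prod,
    MeasureTheory.integral_prod_mul (μ := MeasureTheory.volume) (ν := MeasureTheory.volume)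
      (fun x : UnitAddCircle => (fourier k.1 x : ℂ))
    (fun x : UnitAddCircle => (fourier k.2 x : ℂ)), UnitAddCircle.integral_fourier,
    UnitAddCircle.integral_fourier]
  rcases k with ⟨a, b⟩
  by_cases ha : a = 0 <;> by_cases hb : b = 0 <;> simp [ha, hb]

/-- Mean square of a trigonometric polynomial whose frequencies `g i` may coincide, at most `R` at
a time: by orthogonality only the pairs with `g i = g j` survive, and
`2 |cᵢ cⱼ| ≤ |cᵢ|² + |cⱼ|²`. -/
theorem integral_norm_sq_sum_torusChar_le {ι : Type*} (s : Finset ι) (c : ι → ℂ) (g : ι → ℤ × ℤ)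
    (R : ℝ) (hR : ∀ j ∈ s, ((s.filter fun i => g i = g j).card : ℝ) ≤ R) :
    ∫ p, ‖∑ i ∈ s, c i * torusChar (g i) p‖ ^ 2 ≤ R * ∑ i ∈ s, ‖c i‖ ^ 2 := by
  have hexp : ∀ p, ((‖∑ i ∈ s, c i * torusChar (g i) p‖ ^ 2 : ℝ) : ℂ) =
      ∑ i ∈ s, ∑ j ∈ s, c i * (starRingEnd ℂ) (c j) * torusChar (g i - g j) p := by
    intro p
    rw [Complex.ofReal_pow, ← Complex.mul_conj', map_sum, Finset.sum_mul_sum]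
    refine Finset.sum_congr rfl fun i _ => Finset.sum_congr rfl fun j _ => ?_
    rw [torusChar_sub, map_mul]
    ring
  have hint : ∀ i j, MeasureTheory.Integrable
      (fun p => c i * (starRingEnd ℂ) (c j) * torusChar (g i - g j) p) := fun i j =>
    (continuous_const.mul (continuous_torusChar _)).integrable_of_hasCompactSupport
      (HasCompactSupport.of_compactSpace _)
  have hval : ((∫ p, ‖∑ i ∈ s, c i * torusChar (g i) p‖ ^ 2 : ℝ) : ℂ) =
      ∑ i ∈ s, ∑ j ∈ s, if g i = g j then c i * (starRingEnd ℂ) (c j) else 0 := by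
    rw [← integral_complex_ofReal]
    simp_rw [hexp]
    rw [MeasureTheory.integral_finsetSum _ fun i _ =>
      MeasureTheory.integrable_finsetSum _ fun j _ => hint i j]
    refine Finset.sum_congr rfl fun i _ => ?_
    rw [MeasureTheory.integral_finsetSum _ fun j _ => hint i j]
    refine Finset.sum_congr rfl fun j _ => ?_
    rw [MeasureTheory.integral_const_mul, integral_torusChar]
    simp [sub_eq_zero]
  have hrow : ∀ j ∈ s, ∑ i ∈ s, (if g i = g j then ‖c j‖ ^ 2 else 0) ≤ R * ‖c j‖ ^ 2 := by
    intro j hj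
    rw [← Finset.sum_filter, Finset.sum_const, nsmul_eq_mul]
    exact mul_le_mul_of_nonneg_right (hR j hj) (sq_nonneg _)
  calc ∫ p, ‖∑ i ∈ s, c i * torusChar (g i) p‖ ^ 2
      ≤ ‖((∫ p, ‖∑ i ∈ s, c i * torusChar (g i) p‖ ^ 2 : ℝ) : ℂ)‖ := by
        rw [Complex.norm_real]; exact Real.le_norm_self _
    _ ≤ ∑ i ∈ s, ∑ j ∈ s, if g i = g j then ‖c i‖ * ‖c j‖ else 0 := by
        rw [hval]
        refine (norm_sum_le _ _).trans (Finset.sum_le_sum fun i _ => ?_)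
        refine (norm_sum_le _ _).trans (Finset.sum_le_sum fun j _ => ?_)
        split_ifs <;> simp
    _ ≤ ∑ i ∈ s, ∑ j ∈ s, ((if g i = g j then ‖c i‖ ^ 2 else 0) / 2 +
          (if g i = g j then ‖c j‖ ^ 2 else 0) / 2) := by
        refine Finset.sum_le_sum fun i _ => Finset.sum_le_sum fun j _ => ?_
        split_ifs
        · nlinarith [sq_nonneg (‖c i‖ - ‖c j‖)]
        · simp
    _ = (∑ i ∈ s, ∑ j ∈ s, (if g j = g i then ‖c i‖ ^ 2 else 0)) / 2 +
          (∑ j ∈ s, ∑ i ∈ s, (if g i = g j then ‖c j‖ ^ 2 else 0)) / 2 := by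
        simp_rw [Finset.sum_add_distrib, Finset.sum_div]
        congr 1
        · simp_rw [eq_comm]
        · rw [Finset.sum_comm]
    _ = ∑ j ∈ s, ∑ i ∈ s, (if g i = g j then ‖c j‖ ^ 2 else 0) := add_halves _
    _ ≤ ∑ j ∈ s, R * ‖c j‖ ^ 2 := Finset.sum_le_sum hrow
    _ = _ := by rw [Finset.mul_sum]

theorem continuous_parabolaExpSum (N : ℕ) (a : ℤ → ℂ) : Continuous (parabolaExpSum N a) := by
  unfold parabolaExpSum
  fun_prop

theorem parabolaExpSum_pow_three (N : ℕ) (a : ℤ → ℂ) (p : UnitAddCircle × UnitAddCircle) :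
    parabolaExpSum N a p ^ 3 =
      ∑ q ∈ Finset.Icc (-(N : ℤ)) N ×ˢ Finset.Icc (-(N : ℤ)) N ×ˢ Finset.Icc (-(N : ℤ)) N,
        a q.1 * (a q.2.1 * a q.2.2) *
          torusChar (q.1 + q.2.1 + q.2.2, q.1 ^ 2 + q.2.1 ^ 2 + q.2.2 ^ 2) p := by
  rw [pow_three, parabolaExpSum, Finset.sum_mul_sum, Finset.sum_mul_sum, Finset.sum_product]
  refine Finset.sum_congr rfl fun x _ => ?_
  rw [Finset.sum_product]
  simp_rw [Finset.mul_sum]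
  refine Finset.sum_congr rfl fun y _ => Finset.sum_congr rfl fun z _ => ?_
  simp only [torusChar, fourier_add]
  ring

/-- The reduction of the `L⁶` bound to counting: `‖f‖₆⁶ = ‖f³‖₂²`, and the frequency `(A, B)` occurs
in `f³` once for every triple with sum `A` and sum of squares `B`. The loss `R` in place of
`R ^ (1 / 6)` is immaterial when `R = exp (O (log N / log log N))`. -/
theorem eLpNorm_six_parabolaExpSum_le (N : ℕ) (a : ℤ → ℂ) (R : ℝ) (hR1 : 1 ≤ R)
    (hR : ∀ (A B : ℤ) (S : Finset (ℤ × ℤ × ℤ)),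
      (∀ p ∈ S, |p.1| ≤ N ∧ |p.2.1| ≤ N ∧ |p.2.2| ≤ N) → (∀ p ∈ S, p.1 + p.2.1 + p.2.2 = A) →
      (∀ p ∈ S, p.1 ^ 2 + p.2.1 ^ 2 + p.2.2 ^ 2 = B) → (S.card : ℝ) ≤ R) :
    MeasureTheory.eLpNorm (parabolaExpSum N a) 6
        (MeasureTheory.volume : MeasureTheory.Measure (UnitAddCircle × UnitAddCircle)) ≤
      ENNReal.ofReal (R * Real.sqrt (∑ n ∈ Finset.Icc (-(N : ℤ)) (N : ℤ), ‖a n‖ ^ 2)) := by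
  set E := ∑ n ∈ Finset.Icc (-(N : ℤ)) (N : ℤ), ‖a n‖ ^ 2 with hE
  have hE0 : 0 ≤ E := Finset.sum_nonneg fun _ _ => by positivity
  have hmem : MeasureTheory.MemLp (parabolaExpSum N a) 6
      (MeasureTheory.volume : MeasureTheory.Measure (UnitAddCircle × UnitAddCircle)) :=
    (continuous_parabolaExpSum N a).memLp_of_hasCompactSupport (HasCompactSupport.of_compactSpace _)
  have hsix : ∫ p, ‖parabolaExpSum N a p‖ ^ 6 ≤ R * E ^ 3 := by
    have h1 : ∀ p, ‖parabolaExpSum N a p‖ ^ 6 = ‖parabolaExpSum N a p ^ 3‖ ^ 2 := by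
      intro p; rw [norm_pow]; ring
    simp_rw [h1, parabolaExpSum_pow_three]
    refine (integral_norm_sq_sum_torusChar_le _ _ _ R ?_).trans (le_of_eq ?_)
    · intro j _
      refine hR (j.1 + j.2.1 + j.2.2) (j.1 ^ 2 + j.2.1 ^ 2 + j.2.2 ^ 2) _ ?_ ?_ ?_
      · intro p hp
        simp only [Finset.mem_filter, Finset.mem_product, Finset.mem_Icc] at hp
        simp only [abs_le]
        exact hp.1
      · intro p hp
        exact (Prod.mk.inj (Finset.mem_filter.1 hp).2).1
      · intro p hp
        exact (Prod.mk.inj (Finset.mem_filter.1 hp).2).2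
    · rw [hE, pow_three, Finset.sum_mul_sum, Finset.sum_mul_sum, Finset.sum_product]
      congr 1
      refine Finset.sum_congr rfl fun x _ => ?_
      rw [Finset.sum_product]
      simp_rw [Finset.mul_sum]
      refine Finset.sum_congr rfl fun y _ => Finset.sum_congr rfl fun z _ => ?_
      rw [norm_mul, norm_mul]
      ring
  rw [hmem.eLpNorm_eq_integral_rpow_norm (by norm_num) (by norm_num)]
  refine ENNReal.ofReal_le_ofReal ?_
  have h6 : ENNReal.toReal 6 = ((6 : ℕ) : ℝ) := by norm_num
  simp_rw [h6, Real.rpow_natCast]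
  have hle : R * E ^ 3 ≤ (R * Real.sqrt E) ^ 6 := by
    have : Real.sqrt E ^ 6 = E ^ 3 := by
      rw [show 6 = 2 * 3 from rfl, pow_mul, Real.sq_sqrt hE0]
    rw [mul_pow, this]
    gcongr
    exact le_self_pow₀ hR1 (by norm_num)
  calc _ ≤ ((R * Real.sqrt E) ^ 6) ^ (((6 : ℕ) : ℝ)⁻¹) :=
        Real.rpow_le_rpow (MeasureTheory.integral_nonneg fun _ => by positivity)
          (hsix.trans hle) (by positivity)
    _ = _ := Real.pow_rpow_inv_natCast (by positivity) (by norm_num)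

/-! ### The `L⁶` estimate -/

theorem mainTheorem2 :
    ∃ A C : ℝ, ∃ N₀ : ℕ, 0 < A ∧ 0 < C ∧
      ∀ N : ℕ, N₀ ≤ N → ∀ a : ℤ → ℂ,
        MeasureTheory.eLpNorm (parabolaExpSum N a) 6
            (MeasureTheory.volume : MeasureTheory.Measure (UnitAddCircle × UnitAddCircle)) ≤
          ENNReal.ofReal
            (A * Real.exp (C * (Real.log N / Real.log (Real.log N))) *
              Real.sqrt (∑ n ∈ Finset.Icc (-(N : ℤ)) (N : ℤ), ‖a n‖ ^ 2)) := by
  have hev : ∀ᶠ N : ℕ in Filter.atTop, 2 ≤ Real.log (Real.log N) ∧ 108 ≤ N :=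
    ((Real.tendsto_log_atTop.comp (Real.tendsto_log_atTop.comp
      tendsto_natCast_atTop_atTop)).eventually_ge_atTop 2).and (Filter.eventually_ge_atTop 108)
  obtain ⟨N₀, hN₀⟩ := Filter.eventually_atTop.1 hev
  refine ⟨36, 28, N₀, by norm_num, by norm_num, fun N hN a => ?_⟩
  obtain ⟨hll, h108⟩ := hN₀ N hN
  set D := Real.exp (14 * (Real.log N / Real.log (Real.log N))) with hD
  have hD1 : 1 ≤ D :=
    Real.one_le_exp (mul_nonneg (by norm_num) (div_nonneg (Real.log_natCast_nonneg N)
      (by linarith)))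
  have hD2 : Real.exp (28 * (Real.log N / Real.log (Real.log N))) = D ^ 2 := by
    rw [hD, ← Real.exp_nat_mul]
    congr 1
    push_cast
    ring
  rw [hD2]
  refine eLpNorm_six_parabolaExpSum_le N a _ (by nlinarith) fun A B S =>
    card_triples_le N D hD1 (fun M hM0 hM => card_divisors_le_exp hll hM0 (hM.trans ?_)) A B S
  calc 108 * N ^ 2 ≤ N * N ^ 2 := Nat.mul_le_mul_right _ h108
    _ = N ^ 3 := by ring
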